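/- A \emph{Motzkin path} of length $n\ge 0$ is a lattice path from $(0,0)$ to $(n,0)$ with steps $U=(1,1)$, $D=(1,-1)$, $H=(1,0)$ that never goes below the $x$-axis. Let $S_n(321,3\bar142)$ be the set of permutations $\pi=\pi_1\cdots\pi_n$ of $\{1,\dots,n\}$ such that there are no $i<j<k$ with $\pi_i>\pi_j>\pi_k$, and such that for all $i<j<k$ with $\pi_j>\pi_i>\pi_k$ there is an $m$ with $i<m<j$ and $\pi_m<\pi_k$. Define a map $\phi$ from Motzkin paths of length $n$ to permutations of $\{1,\dots,n\}$ as follows. Let $P$ be a Motzkin path of length $n$ with $k$ up steps. Set $P_k=P$, and for $i=k,k-1,\dots,1$ let $A\to B$ be the last up step and $E\to F$ the last down step of $P_i$. Let $h_i$ be the label of the cell containing the step $E\to F$ and $t_i$ the label of the cell containing the step of $P_i$ that starts at $B$. Here the cell containing a down step, or a horizontal step above the $x$-axis, that starts at $(x,y)$ is respectively the triangle under that down step or the unit square under that horizontal step; the left end of its bottom side is $(x,y-1)$, and its label is $x+y-1$. Let $P_{i-1}$ be the Motzkin path obtained from $P_i$ by moving all points from $B$ to $E$ down by $1$ (so that the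 last up step and the last down step become horizontal). Let $s_i$ act on the right of a permutation by interchanging the entries in positions $i$ and $i+1$, and put $$\phi(P)=(1\,2\,\cdots\,n)\,\sigma_1\sigma_2\cdots\sigma_k,\qquad \sigma_i=s_{h_i}s_{h_i-1}\cdots s_{t_i},$$ where $(1\,2\,\cdots\,n)$ is the identity permutation in one-line notation. \textbf{Theorem.} For every $n\ge 0$, the map $\phi$ is a bijection from the set of Motzkin paths of length $n$ onto $S_n(321,3\bar142)$, and for every Motzkin path $P$ of length $n$ the number of horizontal steps of $P$ lying on the $x$-axis equals the number of fixed points of $\phi(P)$. Consequently, for every $m\ge 0$, $\phi$ restricts to a bijection from the Motzkin paths of length $n$ with exactly $m$ horizontal steps on the $x$-axis onto the permutations in $S_n(321,3\bar142)$ with exactly $m$ fixed points. -/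

import Mathlib

namespace RiordanPaths

/-- The steps of a Motzkin path: `U = (1,1)`, `D = (1,-1)`, `H = (1,0)`. -/
inductive Step
  | U
  | D
  | H
  deriving DecidableEq

/-- The vertical displacement of a step. -/
def Step.rise : Step → ℤ
  | .U => 1
  | .D => -1
  | .H => 0

/-- The `y`-coordinate of the point with `x`-coordinate `i` on the lattice path that starts at
`(0,0)` and whose successive steps are `w 0, w 1, …, w (n-1)`. In particular the step `w j` starts
at the point `(j, height w j)`. -/
def height {n : ℕ} (w : Fin n → Step) (i : ℕ) : ℤ :=
  ∑ j ∈ Finset.univ.filter (fun j : Fin n => (j : ℕ) < i), (w j).rise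

/-- The path ends at `(n,0)` and never goes below the `x`-axis. -/
def IsMotzkin {n : ℕ} (w : Fin n → Step) : Prop :=
  height w n = 0 ∧ ∀ i ≤ n, 0 ≤ height w i

/-- Motzkin paths of length `n`. -/
abbrev MotzkinPath (n : ℕ) := {w : Fin n → Step // IsMotzkin w}

/-- The number of horizontal steps lying on the `x`-axis. -/
def axisHorizontals {n : ℕ} (P : MotzkinPath n) : ℕ :=
  (Finset.univ.filter fun j : Fin n => P.1 j = .H ∧ height P.1 j = 0).card

/-- The number of up steps. -/
def numUps {n : ℕ} (w : Fin n → Step) : ℕ :=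
  (Finset.univ.filter fun j : Fin n => w j = .U).card

/-- The position (counted from `0`) of the last step of kind `s`; it is used only for paths
that have such a step. -/
def lastPos {n : ℕ} (w : Fin n → Step) (s : Step) : ℕ :=
  (Finset.univ.filter fun j : Fin n => w j = s).sup fun j => (j : ℕ)

/-- The label, in the `(x+y)`-labelling, of the cell containing the step that starts at the point
`(j, height w j)`, when this is a down step or a horizontal step above the `x`-axis. The cell is
a triangle below a down step, or the unit square below a horizontal step; in both cases the
left end of its bottom side is `(j, height w j - 1)`, and the label is the sum of these
coordinates. -/
def cellLabel {n : ℕ} (w : Fin n → Step) (j : ℕ) : ℕ :=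
  ((j : ℤ) + (height w j - 1)).toNat

/-- `h`: the label of the cell containing the last down step `E → F`. -/
def stripHead {n : ℕ} (w : Fin n → Step) : ℕ :=
  cellLabel w (lastPos w .D)

/-- `t`: the label of the cell containing the step that starts at `B`, where `A → B` is the last
up step. -/
def stripTail {n : ℕ} (w : Fin n → Step) : ℕ :=
  cellLabel w (lastPos w .U + 1)

/-- Removing the strip: all points from `B` to `E` are moved down by one, so that the last up
step `A → B` and the last down step `E → F` become horizontal, and the other steps stay. -/
def removeStrip {n : ℕ} (w : Fin n → Step) : Fin n → Step := fun j =>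
  if (j : ℕ) = lastPos w .U ∨ (j : ℕ) = lastPos w .D then .H else w j

/-- The parameters `[(h₁, t₁), …, (h_k, t_k)]` of the strip decomposition of a path with `k` up
steps. -/
def stripParams {n : ℕ} : ℕ → (Fin n → Step) → List (ℕ × ℕ)
  | 0, _ => []
  | k + 1, w => stripParams k (removeStrip w) ++ [(stripHead w, stripTail w)]

/-- The simple transposition `s_i`, `1 ≤ i ≤ n - 1`, of the positions `i` and `i + 1`. The
positions `1, …, n` are the elements `0, …, n - 1` of `Fin n`. Right multiplication
`π * simple n i` interchanges the entries of `π` in positions `i` and `i + 1`. -/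
def simple (n i : ℕ) : Equiv.Perm (Fin n) :=
  if h : 1 ≤ i ∧ i < n then
    Equiv.swap ⟨i - 1, (Nat.sub_le i 1).trans_lt h.2⟩ ⟨i, h.2⟩
  else 1

/-- `s_h s_{h-1} ⋯ s_t`. -/
def descendingRun (n h t : ℕ) : Equiv.Perm (Fin n) :=
  ((List.range' t (h + 1 - t)).reverse.map (simple n)).prod

/-- The map `φ`: the path with strip parameters `(h₁, t₁), …, (h_k, t_k)` is sent to the
permutation `σ₁ σ₂ ⋯ σ_k` with `σ_i = s_{h_i} s_{h_i - 1} ⋯ s_{t_i}`. -/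
def phi {n : ℕ} (P : MotzkinPath n) : Equiv.Perm (Fin n) :=
  ((stripParams (numUps P.1) P.1).map fun p => descendingRun n p.1 p.2).prod

/-- No subsequence of pattern `321`. -/
def Avoids321 {n : ℕ} (π : Equiv.Perm (Fin n)) : Prop :=
  ¬ ∃ i j k : Fin n, i < j ∧ j < k ∧ π j < π i ∧ π k < π j

/-- Avoidance of the barred pattern: every subsequence of pattern `231` extends to one of
pattern `3142`. -/
def Avoids3bar142 {n : ℕ} (π : Equiv.Perm (Fin n)) : Prop :=
  ∀ i j k : Fin n, i < j → j < k → π i < π j → π k < π i →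
    ∃ m : Fin n, i < m ∧ m < j ∧ π m < π k

/-- The permutations of `n` letters that avoid both patterns. -/
def avoiders (n : ℕ) : Set (Equiv.Perm (Fin n)) :=
  {π | Avoids321 π ∧ Avoids3bar142 π}

/-- The number of fixed points. -/
def numFixed {n : ℕ} (π : Equiv.Perm (Fin n)) : ℕ :=
  (Finset.univ.filter fun i : Fin n => π i = i).card

end RiordanPaths

/-! Let the up steps of a path start at abscissas u_0 < u_1 < ⋯ and its down steps at d_0 < d_1 < ⋯.
The Motzkin condition says that the two lists are equally long and that u_i < d_i. Counting from 0,
the i-th strip has head d_i and tail p_i + 1, where p_i = u_i + #{j < i : d_j > u_i} is `shift d i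
(u i)` (`stripHead_eq`, `stripTail_eq`). Moreover p_i < d_i and p_{i+1} ≥ p_i + 2.

With positions counted from 0, the i-th run sends p_i to d_i and lowers p_i + 1, …, d_i by one.
Under the conditions `RunData`, the product of the runs therefore has the excedances p_i ↦ d_i and
no others, increases on the remaining positions, and fixes x exactly when x lies in no interval
[p_i, d_i]. The last condition also characterizes the horizontal steps on the axis (`axis_iff`).

Two increasing subsequences leave no room for 321, and the gap between excedances supplies the small
entry required by the barred pattern. Conversely, a 321-avoiding permutation increases on its
excedances and off them, so it is determined by their positions and values; the barred pattern
forbids adjacent excedances (`ne_succ`). Thus the avoiders correspond to the pairs (p, d) with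
`RunData`. Finally u is recovered from (p, d) because `shift d i` is strictly increasing off the d_j
with j < i and takes there every value ≥ i (`shift_lt`, `exists_shift_eq`). -/

namespace RiordanPaths

/-! ### Enumerations of finite sets of natural numbers -/

/-- `u 0 < u 1 < ⋯ < u (k-1)` are the natural numbers that satisfy `q`. -/
structure Enumerates (k : ℕ) (u : ℕ → ℕ) (q : ℕ → Prop) : Prop where
  lt : ∀ i j, i < j → j < k → u i < u j
  iff : ∀ x, q x ↔ ∃ i < k, u i = x

theorem Enumerates.mem {k : ℕ} {u : ℕ → ℕ} {q : ℕ → Prop} (h : Enumerates k u q) {i : ℕ}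
    (hi : i < k) : q (u i) :=
  (h.iff _).2 ⟨i, hi, rfl⟩

theorem Enumerates.inj {k : ℕ} {u : ℕ → ℕ} {q : ℕ → Prop} (h : Enumerates k u q) {i j : ℕ}
    (hi : i < k) (hj : j < k) (e : u i = u j) : i = j := by
  rcases lt_trichotomy i j with hij | hij | hij
  · have := h.lt i j hij hj
    omega
  · exact hij
  · have := h.lt j i hij hi
    omega

theorem Enumerates.of_lt {k : ℕ} {u : ℕ → ℕ} {q : ℕ → Prop} (h : Enumerates k u q) {i j : ℕ}
    (hi : i < k) (e : u i < u j) : i < j := by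
  rcases lt_trichotomy i j with hij | hij | hij
  · exact hij
  · subst hij
    omega
  · have := h.lt j i hij hi
    omega

theorem exists_enumerates (s : Finset ℕ) : ∃ u, Enumerates s.card u (· ∈ s) := by
  refine ⟨fun i => if h : i < s.card then s.orderEmbOfFin rfl ⟨i, h⟩ else 0, ?_, ?_⟩
  · intro i j hij hj
    simp only [dif_pos hj, dif_pos (hij.trans hj)]
    exact (s.orderEmbOfFin rfl).strictMono hij
  · intro x
    have h := s.range_orderEmbOfFin rfl
    have hx : x ∈ s ↔ x ∈ Set.range (s.orderEmbOfFin rfl) := by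
      rw [h]
      rfl
    rw [hx]
    constructor
    · rintro ⟨i, hi⟩
      exact ⟨i, i.2, by rw [dif_pos i.2]; exact hi⟩
    · rintro ⟨i, hi, e⟩
      rw [dif_pos hi] at e
      exact ⟨_, e⟩

theorem Enumerates.card_eq {k : ℕ} {u : ℕ → ℕ} {q : ℕ → Prop} (h : Enumerates k u q)
    {s : Finset ℕ} (hs : ∀ x, x ∈ s ↔ q x) : s.card = k := by
  have : s = (Finset.range k).image u := by
    ext x
    rw [hs, h.iff]
    simp
  rw [this, Finset.card_image_of_injOn, Finset.card_range]
  intro i hi j hj e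
  exact h.inj (by simpa using hi) (by simpa using hj) e

theorem Enumerates.unique {k l : ℕ} {u v : ℕ → ℕ} {q : ℕ → Prop} (hu : Enumerates k u q)
    (hv : Enumerates l v q) : k = l ∧ ∀ i < k, u i = v i := by
  have hkl : k = l := by
    rw [← hu.card_eq (s := (Finset.range l).image v) (fun x => by rw [hv.iff]; simp)]
    exact hv.card_eq (fun x => by rw [hv.iff]; simp)
  subst hkl
  refine ⟨rfl, ?_⟩
  intro i
  induction i using Nat.strong_induction_on with
  | _ i ih =>
    intro hi
    obtain ⟨j, hj, ej⟩ := (hv.iff _).1 (hu.mem hi)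
    obtain ⟨l, hl, el⟩ := (hu.iff _).1 (hv.mem hi)
    rcases lt_trichotomy i j with h | h | h
    · have h1 := hv.lt i j h hj
      have h2 := hu.of_lt hl (show u l < u i by omega)
      have h3 := ih l h2 hl
      have := hv.inj hl hi (by omega)
      omega
    · rw [← ej, h]
    · have h3 := ih j h hj
      have := hu.inj hj hi (by omega)
      omega

theorem Enumerates.card_filter_lt {k n : ℕ} {u : ℕ → ℕ} {q : Fin n → Prop} [DecidablePred q]
    (h : Enumerates k u fun x => ∃ hx : x < n, q ⟨x, hx⟩) (x : ℕ) :
    (Finset.univ.filter fun j : Fin n => (j : ℕ) < x ∧ q j).card =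
      ((Finset.range k).filter (u · < x)).card := by
  symm
  refine Finset.card_bij' (t := Finset.univ.filter fun j : Fin n => (j : ℕ) < x ∧ q j)
    (fun i hi => ⟨u i, (h.mem (by simpa using (Finset.mem_filter.1 hi).1)).1⟩)
    (fun j hj => ((h.iff j).1 ⟨j.2, (Finset.mem_filter.1 hj).2.2⟩).choose) ?_ ?_ ?_ ?_
  · intro i hi
    simp only [Finset.mem_filter, Finset.mem_range, Finset.mem_univ, true_and] at hi ⊢
    exact ⟨hi.2, (h.mem hi.1).2⟩
  · intro j hj
    have hs := ((h.iff j).1 ⟨j.2, (Finset.mem_filter.1 hj).2.2⟩).choose_spec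
    simp only [Finset.mem_filter, Finset.mem_range, Finset.mem_univ, true_and] at hj ⊢
    refine ⟨hs.1, ?_⟩
    rw [hs.2]
    exact hj.1
  · intro i hi
    have hi' : i < k := by simpa using (Finset.mem_filter.1 hi).1
    have hs := ((h.iff (u i)).1 (h.mem hi')).choose_spec
    exact h.inj hs.1 hi' hs.2
  · intro j hj
    have hs := ((h.iff j).1 ⟨j.2, (Finset.mem_filter.1 hj).2.2⟩).choose_spec
    exact Fin.ext hs.2

/-! ### The shift function -/

/-- `x` plus the number of the points `d 0, …, d (i-1)` that lie to the right of `x`. -/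
def shift (d : ℕ → ℕ) (i x : ℕ) : ℕ :=
  x + ((Finset.range i).filter (x < d ·)).card

theorem le_shift (d : ℕ → ℕ) (i x : ℕ) : x ≤ shift d i x :=
  Nat.le_add_right _ _

theorem shift_of_le {d : ℕ → ℕ} {i x : ℕ} (h : ∀ j < i, d j ≤ x) : shift d i x = x := by
  rw [shift, Finset.card_eq_zero.2, add_zero]
  refine Finset.filter_eq_empty_iff.2 fun j hj => ?_
  exact not_lt.2 (h j (by simpa using hj))

theorem shift_le_add (d : ℕ → ℕ) (i x : ℕ) : shift d i x ≤ x + i := by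
  rw [shift]
  have := Finset.card_filter_le (Finset.range i) (x < d ·)
  rw [Finset.card_range] at this
  omega

theorem shift_succ (d : ℕ → ℕ) (i x : ℕ) :
    shift d (i + 1) x = shift d i x + if x < d i then 1 else 0 := by
  rw [shift, shift, Finset.range_add_one, Finset.filter_insert]
  split_ifs with h
  · rw [Finset.card_insert_of_notMem (by simp)]
    omega
  · rfl

theorem shift_succ_right_le (d : ℕ → ℕ) (i x : ℕ) : shift d i (x + 1) ≤ shift d i x + 1 := by
  have : ((Finset.range i).filter (x + 1 < d ·)).card ≤
      ((Finset.range i).filter (x < d ·)).card :=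
    Finset.card_le_card (Finset.monotone_filter_right _ fun j _ hj => by
      omega)
  rw [shift, shift]
  omega

theorem shift_succ_right_le_of_eq {d : ℕ → ℕ} {i j x : ℕ} (hj : j < i) (e : d j = x + 1) :
    shift d i (x + 1) ≤ shift d i x := by
  have : ((Finset.range i).filter (x + 1 < d ·)).card <
      ((Finset.range i).filter (x < d ·)).card := by
    refine Finset.card_lt_card ⟨Finset.monotone_filter_right _ fun j _ hj => by
      omega, fun h => ?_⟩
    have : j ∈ (Finset.range i).filter (x + 1 < d ·) := h (by simp [hj, e])
    simp [e] at this
  rw [shift, shift]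
  omega

theorem card_between_le {d : ℕ → ℕ} {i : ℕ} (hd : ∀ a b, a < b → b < i → d a < d b)
    (s : Finset ℕ) : ((Finset.range i).filter (d · ∈ s)).card ≤ s.card := by
  refine Finset.card_le_card_of_injOn d (fun j hj => ?_) ?_
  · exact (Finset.mem_filter.1 hj).2
  · intro a ha b hb e
    have ha' : a < i := by simpa using (Finset.mem_filter.1 ha).1
    have hb' : b < i := by simpa using (Finset.mem_filter.1 hb).1
    rcases lt_trichotomy a b with h | h | h
    · have := hd a b h hb'
      omega
    · exact h
    · have := hd b a h ha'
      omega

/-- Passing from x to y loses only the d_j in (x, y], and there are at most y - x of them. -/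
theorem shift_mono {d : ℕ → ℕ} {i x y : ℕ} (hd : ∀ a b, a < b → b < i → d a < d b)
    (hxy : x ≤ y) : shift d i x ≤ shift d i y := by
  have h1 := card_between_le hd (Finset.Ioc x y)
  have h2 : (Finset.range i).filter (x < d ·) ⊆
      (Finset.range i).filter (y < d ·) ∪ (Finset.range i).filter (d · ∈ Finset.Ioc x y) := by
    intro j hj
    simp only [Finset.mem_filter, Finset.mem_union, Finset.mem_Ioc] at hj ⊢
    have := hj.1
    by_cases h : y < d j
    · exact Or.inl ⟨this, h⟩
    · exact Or.inr ⟨this, hj.2, by omega⟩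
  have h3 := (Finset.card_le_card h2).trans (Finset.card_union_le _ _)
  rw [Nat.card_Ioc] at h1
  rw [shift, shift]
  omega

/-- As y is not a d_j, the lost points lie in the open interval (x, y), which leaves a gain of at
least one. -/
theorem shift_lt {d : ℕ → ℕ} {i x y : ℕ} (hd : ∀ a b, a < b → b < i → d a < d b)
    (hxy : x < y) (hy : ∀ j < i, d j ≠ y) : shift d i x < shift d i y := by
  have h1 := card_between_le hd (Finset.Ioo x y)
  have h2 : (Finset.range i).filter (x < d ·) ⊆
      (Finset.range i).filter (y < d ·) ∪ (Finset.range i).filter (d · ∈ Finset.Ioo x y) := by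
    intro j hj
    simp only [Finset.mem_filter, Finset.mem_union, Finset.mem_Ioo] at hj ⊢
    have := hj.1
    have hne := hy j (by simpa using hj.1)
    by_cases h : y < d j
    · exact Or.inl ⟨this, h⟩
    · exact Or.inr ⟨this, hj.2, by omega⟩
  have h3 := (Finset.card_le_card h2).trans (Finset.card_union_le _ _)
  rw [Nat.card_Ioo] at h1
  rw [shift, shift]
  omega

/-- The shift takes every value `≥ i` at a point different from the `d j`. -/
theorem exists_shift_eq {d : ℕ → ℕ} {i y : ℕ} (h0 : ∀ j < i, d j ≠ 0) (hy : i ≤ y) :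
    ∃ x, shift d i x = y ∧ ∀ j < i, d j ≠ x := by
  classical
  -- The least such x works: the shift rises by at most one per step, so y is not skipped, and it
  -- does not rise on reaching some d_j, so x is none of them.
  have hex : ∃ x, y ≤ shift d i x := ⟨y, le_shift d i y⟩
  have hs := Nat.find_spec hex
  have hm : ∀ {m}, m < Nat.find hex → ¬ y ≤ shift d i m := fun h => Nat.find_min hex h
  generalize Nat.find hex = x at hs hm
  refine ⟨x, ?_⟩
  cases x with
  | zero =>
    have := shift_le_add d i 0
    exact ⟨by omega, h0⟩
  | succ x =>
    have h1 := hm (Nat.lt_succ_self x)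
    have h2 := shift_succ_right_le d i x
    refine ⟨by omega, fun j hj e => ?_⟩
    have := shift_succ_right_le_of_eq hj e
    omega

/-! ### Encoding a path by the positions of its up and down steps -/

/-- The path `w` has `k` up steps, at `u 0 < u 1 < ⋯`, and `k` down steps, at `d 0 < d 1 < ⋯`, and
the `i`-th up step precedes the `i`-th down step. -/
structure Encodes {n : ℕ} (w : Fin n → Step) (k : ℕ) (u d : ℕ → ℕ) : Prop where
  up : Enumerates k u fun x => ∃ hx : x < n, w ⟨x, hx⟩ = .U
  down : Enumerates k d fun x => ∃ hx : x < n, w ⟨x, hx⟩ = .D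
  lt : ∀ i < k, u i < d i

theorem height_eq_card_sub_card {n : ℕ} (w : Fin n → Step) (x : ℕ) :
    height w x = ((Finset.univ.filter fun j : Fin n => (j : ℕ) < x ∧ w j = .U).card : ℤ) -
      (Finset.univ.filter fun j : Fin n => (j : ℕ) < x ∧ w j = .D).card := by
  have h : ∀ s : Step, s.rise = (if s = .U then 1 else 0) - (if s = .D then 1 else 0) := by
    intro s
    cases s <;> simp [Step.rise]
  simp only [height, h, Finset.sum_sub_distrib, Finset.sum_boole, Finset.filter_filter]

theorem height_eq_of_enumerates {n : ℕ} {w : Fin n → Step} {k l : ℕ} {u d : ℕ → ℕ}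
    (hu : Enumerates k u fun x => ∃ hx : x < n, w ⟨x, hx⟩ = .U)
    (hd : Enumerates l d fun x => ∃ hx : x < n, w ⟨x, hx⟩ = .D) (x : ℕ) :
    height w x = (((Finset.range k).filter (u · < x)).card : ℤ) -
      ((Finset.range l).filter (d · < x)).card := by
  rw [height_eq_card_sub_card, hu.card_filter_lt, hd.card_filter_lt]

theorem filter_lt_top {n : ℕ} {w : Fin n → Step} {k : ℕ} {u : ℕ → ℕ} {s : Step}
    (hu : Enumerates k u fun x => ∃ hx : x < n, w ⟨x, hx⟩ = s) :
    (Finset.range k).filter (u · < n) = Finset.range k :=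
  Finset.filter_true_of_mem fun _ hi => (hu.mem (by simpa using hi)).1

theorem exists_enumerates_step {n : ℕ} (w : Fin n → Step) (s : Step) :
    ∃ k u, Enumerates k u fun x => ∃ hx : x < n, w ⟨x, hx⟩ = s := by
  obtain ⟨u, hu⟩ := exists_enumerates ((Finset.univ.filter fun j => w j = s).map Fin.valEmbedding)
  refine ⟨_, u, hu.lt, fun x => ?_⟩
  rw [← hu.iff]
  simp only [Finset.mem_map, Finset.mem_filter, Finset.mem_univ, true_and, Fin.valEmbedding_apply]
  constructor
  · rintro ⟨hx, e⟩
    exact ⟨_, e, rfl⟩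
  · rintro ⟨j, e, rfl⟩
    exact ⟨j.2, e⟩

theorem IsMotzkin.exists_encodes {n : ℕ} {w : Fin n → Step} (hw : IsMotzkin w) :
    ∃ k u d, Encodes w k u d := by
  obtain ⟨k, u, hu⟩ := exists_enumerates_step w .U
  obtain ⟨l, d, hd⟩ := exists_enumerates_step w .D
  have h1 := hw.1
  rw [height_eq_of_enumerates hu hd, filter_lt_top hu, filter_lt_top hd, Finset.card_range,
    Finset.card_range] at h1
  have hkl : k = l := by omega
  subst hkl
  refine ⟨k, u, d, hu, hd, fun i hi => ?_⟩
  obtain ⟨hdn, hdi⟩ := hd.mem hi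
  have h2 := hw.2 (d i + 1) hdn
  rw [height_eq_of_enumerates hu hd] at h2
  -- Just after the `i`-th down step, at least i + 1 down steps have been made; if `u i` came later,
  -- at most i up steps would have been made and the height would be negative.
  have h3 : i + 1 ≤ ((Finset.range k).filter (d · < d i + 1)).card := by
    refine (Finset.card_range (i + 1)).ge.trans (Finset.card_le_card fun j hj => by
    rw [Finset.mem_range] at hj
    rw [Finset.mem_filter, Finset.mem_range]
    rcases (Nat.lt_succ_iff_lt_or_eq.1 hj) with h | h
    · have := hd.lt j i h hi
      omega
    · subst h
      omega)
  by_contra hlt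
  have hne : u i ≠ d i := by
    intro e
    obtain ⟨hun, hui⟩ := hu.mem hi
    simp only [e] at hui
    rw [hui] at hdi
    cases hdi
  have h4 : ((Finset.range k).filter (u · < d i + 1)).card ≤ i := by
    refine le_of_le_of_eq (Finset.card_le_card fun j hj => by
    rw [Finset.mem_filter, Finset.mem_range] at hj
    rw [Finset.mem_range]
    by_contra hij
    rcases eq_or_lt_of_le (not_lt.1 hij) with h | h
    · subst h
      omega
    · have := hu.lt i j h hj.1
      omega) (Finset.card_range i)
  omega

namespace Encodes

variable {n k : ℕ} {w : Fin n → Step} {u d : ℕ → ℕ}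

theorem isMotzkin (h : Encodes w k u d) : IsMotzkin w := by
  refine ⟨?_, fun x _ => ?_⟩
  · rw [height_eq_of_enumerates h.up h.down, filter_lt_top h.up, filter_lt_top h.down]
    simp
  · rw [height_eq_of_enumerates h.up h.down]
    have : ((Finset.range k).filter (d · < x)).card ≤ ((Finset.range k).filter (u · < x)).card := by
      refine Finset.card_le_card fun j hj => ?_
      rw [Finset.mem_filter, Finset.mem_range] at hj ⊢
      have := h.lt j hj.1
      omega
    omega

theorem numUps_eq (h : Encodes w k u d) : numUps w = k := by
  have := h.up.card_filter_lt (q := fun j => w j = .U) n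
  rw [filter_lt_top h.up, Finset.card_range] at this
  rw [← this, numUps]
  congr 1
  ext j
  simp

theorem ne (h : Encodes w k u d) {i j : ℕ} (hi : i < k) (hj : j < k) : u i ≠ d j := by
  intro e
  obtain ⟨hun, hui⟩ := h.up.mem hi
  obtain ⟨hdn, hdi⟩ := h.down.mem hj
  simp only [e] at hui
  rw [hui] at hdi
  cases hdi

theorem path_ext {w' : Fin n → Step} {u' d' : ℕ → ℕ} (h : Encodes w k u d)
    (h' : Encodes w' k u' d') (hu : ∀ i < k, u i = u' i) (hd : ∀ i < k, d i = d' i) : w = w' := by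
  have key : ∀ s : Step, s = .U ∨ s = .D → ∀ x, w x = s ↔ w' x = s := by
    rintro s (rfl | rfl) x
    · have h1 : w x = .U ↔ ∃ i < k, u i = x :=
        ⟨fun e => (h.up.iff x).1 ⟨x.2, e⟩, fun e => ((h.up.iff x).2 e).2⟩
      have h2 : w' x = .U ↔ ∃ i < k, u' i = x :=
        ⟨fun e => (h'.up.iff x).1 ⟨x.2, e⟩, fun e => ((h'.up.iff x).2 e).2⟩
      rw [h1, h2]
      exact exists_congr fun i => and_congr_right fun hi => by rw [hu i hi]
    · have h1 : w x = .D ↔ ∃ i < k, d i = x :=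
        ⟨fun e => (h.down.iff x).1 ⟨x.2, e⟩, fun e => ((h.down.iff x).2 e).2⟩
      have h2 : w' x = .D ↔ ∃ i < k, d' i = x :=
        ⟨fun e => (h'.down.iff x).1 ⟨x.2, e⟩, fun e => ((h'.down.iff x).2 e).2⟩
      rw [h1, h2]
      exact exists_congr fun i => and_congr_right fun hi => by rw [hd i hi]
  funext x
  have hU := key .U (Or.inl rfl) x
  have hD := key .D (Or.inr rfl) x
  cases e : w x <;> cases e' : w' x <;> simp_all

/-! ### The strip decomposition -/

theorem lastPos_eq {s : Step} {v : ℕ → ℕ}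
    (h : Enumerates (k + 1) v fun x => ∃ hx : x < n, w ⟨x, hx⟩ = s) : lastPos w s = v k := by
  obtain ⟨hn, hv⟩ := h.mem (Nat.lt_succ_self k)
  refine le_antisymm (Finset.sup_le fun j hj => ?_) ?_
  · obtain ⟨i, hi, e⟩ := (h.iff j).1 ⟨j.2, (Finset.mem_filter.1 hj).2⟩
    rw [← e]
    rcases Nat.lt_succ_iff_lt_or_eq.1 hi with h1 | h1
    · exact (h.lt i k h1 (Nat.lt_succ_self k)).le
    · rw [h1]
  · exact Finset.le_sup (f := fun j : Fin n => (j : ℕ)) (b := ⟨v k, hn⟩) (by simpa using hv)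

/-- The sequences `u` and `d` serve unchanged for the shorter path, so the recursion on strips needs
no reindexing. -/
theorem removeStrip (h : Encodes w (k + 1) u d) : Encodes (removeStrip w) k u d := by
  have hr : ∀ x : Fin n, RiordanPaths.removeStrip w x =
      if (x : ℕ) = u k ∨ (x : ℕ) = d k then .H else w x := by
    intro x
    rw [RiordanPaths.removeStrip, lastPos_eq h.up, lastPos_eq h.down]
  have hk := Nat.lt_succ_self k
  refine ⟨⟨fun i j hij hj => h.up.lt i j hij (by omega), fun x => ?_⟩,
    ⟨fun i j hij hj => h.down.lt i j hij (by omega), fun x => ?_⟩, fun i hi => h.lt i (by omega)⟩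
  · constructor
    · rintro ⟨hx, e⟩
      rw [hr] at e
      split_ifs at e with hc
      obtain ⟨i, hi, rfl⟩ := (h.up.iff x).1 ⟨hx, e⟩
      refine ⟨i, lt_of_le_of_ne (by omega) ?_, rfl⟩
      rintro rfl
      exact hc (Or.inl rfl)
    · rintro ⟨i, hi, rfl⟩
      obtain ⟨hx, e⟩ := h.up.mem (show i < k + 1 by omega)
      refine ⟨hx, ?_⟩
      rw [hr, if_neg, e]
      rintro (hc | hc)
      · have := h.up.lt i k hi hk
        simp only at hc
        omega
      · exact h.ne (by omega) hk hc
  · constructor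
    · rintro ⟨hx, e⟩
      rw [hr] at e
      split_ifs at e with hc
      obtain ⟨i, hi, rfl⟩ := (h.down.iff x).1 ⟨hx, e⟩
      refine ⟨i, lt_of_le_of_ne (by omega) ?_, rfl⟩
      rintro rfl
      exact hc (Or.inr rfl)
    · rintro ⟨i, hi, rfl⟩
      obtain ⟨hx, e⟩ := h.down.mem (show i < k + 1 by omega)
      refine ⟨hx, ?_⟩
      rw [hr, if_neg, e]
      rintro (hc | hc)
      · exact h.ne hk (by omega) hc.symm
      · have := h.down.lt i k hi hk
        simp only at hc
        omega

/-- All k + 1 up steps and k of the down steps precede the last down step, so it starts at height 1.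
-/
theorem stripHead_eq (h : Encodes w (k + 1) u d) : stripHead w = d k := by
  have hk := Nat.lt_succ_self k
  rw [stripHead, lastPos_eq h.down, cellLabel, height_eq_of_enumerates h.up h.down]
  have h1 : (Finset.range (k + 1)).filter (u · < d k) = Finset.range (k + 1) := by
    refine Finset.filter_true_of_mem fun i hi => ?_
    rw [Finset.mem_range] at hi
    have h2 := h.lt k hk
    rcases Nat.lt_succ_iff_lt_or_eq.1 hi with h3 | rfl
    · have := h.up.lt i k h3 hk
      omega
    · exact h2
  have h2 : (Finset.range (k + 1)).filter (d · < d k) = Finset.range k := by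
    ext i
    rw [Finset.mem_filter, Finset.mem_range, Finset.mem_range]
    constructor
    · rintro ⟨hi, e⟩
      exact h.down.of_lt hi e
    · intro hi
      exact ⟨by omega, h.down.lt i k hi hk⟩
  rw [h1, h2, Finset.card_range, Finset.card_range]
  push_cast
  omega

/-- The height of B is k + 1 minus the number of down steps before `u k`, that is, 1 plus the number
of j < k with `d j` beyond `u k`. -/
theorem stripTail_eq (h : Encodes w (k + 1) u d) : stripTail w = shift d k (u k) + 1 := by
  have hk := Nat.lt_succ_self k
  rw [stripTail, lastPos_eq h.up, cellLabel, height_eq_of_enumerates h.up h.down, shift]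
  have h1 : (Finset.range (k + 1)).filter (u · < u k + 1) = Finset.range (k + 1) := by
    refine Finset.filter_true_of_mem fun i hi => ?_
    rw [Finset.mem_range] at hi
    rcases Nat.lt_succ_iff_lt_or_eq.1 hi with h3 | rfl
    · have := h.up.lt i k h3 hk
      omega
    · omega
  have h2 : (Finset.range (k + 1)).filter (d · < u k + 1) =
      (Finset.range k).filter (¬ u k < d ·) := by
    ext i
    rw [Finset.mem_filter, Finset.mem_filter, Finset.mem_range, Finset.mem_range]
    constructor
    · rintro ⟨hi, e⟩
      refine ⟨lt_of_le_of_ne (by omega) ?_, by omega⟩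
      rintro rfl
      have := h.lt i hk
      omega
    · rintro ⟨hi, e⟩
      exact ⟨by omega, by omega⟩
  have h3 := Finset.card_filter_add_card_filter_not (s := Finset.range k) (u k < d ·)
  rw [Finset.card_range] at h3
  rw [h1, h2, Finset.card_range]
  push_cast
  omega

theorem stripParams_eq (h : Encodes w k u d) :
    stripParams k w = (List.range k).map fun i => (d i, shift d i (u i) + 1) := by
  induction k generalizing w with
  | zero => rfl
  | succ k ih =>
    rw [stripParams, ih h.removeStrip, h.stripHead_eq, h.stripTail_eq, List.range_succ,
      List.map_append]
    rfl

/-! ### Properties of the numbers `shift d i (u i)` -/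

/-- One unit comes from strict growth of `shift d (i + 1)` between `u i` and `u (i + 1)`, the other
from the new point `d i`, which lies to the right of `u i`. -/
theorem shift_spacing (h : Encodes w k u d) {i : ℕ} (hi : i + 1 < k) :
    shift d i (u i) + 2 ≤ shift d (i + 1) (u (i + 1)) := by
  have h1 := shift_lt (d := d) (i := i + 1) (x := u i) (y := u (i + 1))
    (fun a b hab hb => h.down.lt a b hab (by omega)) (h.up.lt i (i + 1) (by omega) hi)
    fun j hj e => h.ne hi (by omega) e.symm
  rw [shift_succ, if_pos (h.lt i (by omega))] at h1
  omega

theorem shift_lt_down (h : Encodes w k u d) {i : ℕ} (hi : i < k) : shift d i (u i) < d i := by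
  have h1 := shift_lt (d := d) (i := i) (x := u i) (y := d i)
    (fun a b hab hb => h.down.lt a b hab (by omega)) (h.lt i hi)
    fun j hj e => by
      have := h.down.lt j i hj hi
      omega
  rwa [shift_of_le (x := d i) fun j hj => (h.down.lt j i hj hi).le] at h1

theorem axis_iff (h : Encodes w k u d) (x : Fin n) :
    (w x = .H ∧ height w x = 0) ↔ ∀ i < k, d i < x ∨ (x : ℕ) < shift d i (u i) := by
  constructor
  · rintro ⟨hH, h0⟩ i hi
    rw [height_eq_of_enumerates h.up h.down] at h0
    have hsub : (Finset.range k).filter (d · < (x : ℕ)) ⊆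
        (Finset.range k).filter (u · < (x : ℕ)) := by
      intro j hj
      rw [Finset.mem_filter, Finset.mem_range] at hj ⊢
      have := h.lt j hj.1
      omega
    -- At height 0 the pairs whose down step is passed are exactly those whose up step is passed.
    have heq := Finset.eq_of_subset_of_card_le hsub (by omega)
    have hmem := Finset.ext_iff.1 heq i
    simp only [Finset.mem_filter, Finset.mem_range, hi, true_and] at hmem
    have hne : u i ≠ x := by
      intro e
      have := ((h.up.iff x).2 ⟨i, hi, e⟩).2
      rw [hH] at this
      cases this
    have := le_shift d i (u i)
    omega
  · intro hx
    -- The tail `shift d i (u i)` may be replaced by `u i`: if every earlier `d j` is at most x, the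
    -- shift fixes x and monotonicity applies; otherwise some j < i has `d j` > x, so x < `u j` < `u
    -- i` by induction.
    have key : ∀ i < k, d i < x ∨ (x : ℕ) < u i := by
      intro i
      induction i using Nat.strong_induction_on with
      | _ i ih =>
        intro hi
        by_cases hdi : d i < x
        · exact Or.inl hdi
        right
        by_contra hu
        by_cases hall : ∀ j < i, d j ≤ x
        · have h1 := shift_mono (d := d) (i := i)
            (fun a b hab hb => h.down.lt a b hab (by omega)) (not_lt.1 hu)
          rw [shift_of_le hall] at h1
          rcases hx i hi with h2 | h2 <;> omega
        · push Not at hall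
          obtain ⟨j, hj, hjx⟩ := hall
          have h2 := h.up.lt j i hj hi
          rcases ih j hj (hj.trans hi) with h3 | h3 <;> omega
    refine ⟨?_, ?_⟩
    · cases e : w x with
      | H => rfl
      | U =>
        obtain ⟨i, hi, e⟩ := (h.up.iff x).1 ⟨x.2, e⟩
        have := h.lt i hi
        rcases key i hi with h1 | h1 <;> omega
      | D =>
        obtain ⟨i, hi, e⟩ := (h.down.iff x).1 ⟨x.2, e⟩
        have := h.lt i hi
        rcases key i hi with h1 | h1 <;> omega
    · rw [height_eq_of_enumerates h.up h.down, sub_eq_zero]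
      congr 2
      refine Finset.filter_congr fun i hi => ?_
      rw [Finset.mem_range] at hi
      have := h.lt i hi
      have := key i hi
      omega

end Encodes

/-! ### Products of descending runs -/

theorem descendingRun_apply {n p d : ℕ} (hpd : p ≤ d) (hd : d < n) (x : Fin n) :
    (descendingRun n d (p + 1) x : ℕ) =
      if (x : ℕ) = p then d else if p < (x : ℕ) ∧ (x : ℕ) ≤ d then (x : ℕ) - 1 else x := by
  obtain ⟨l, rfl⟩ := Nat.exists_eq_add_of_le hpd
  clear hpd
  induction l with
  | zero =>
    have : descendingRun n (p + 0) (p + 1) = 1 := by simp [descendingRun]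
    rw [this, Equiv.Perm.one_apply]
    split_ifs <;> omega
  | succ l ih =>
    have h : descendingRun n (p + (l + 1)) (p + 1) =
        simple n (p + l + 1) * descendingRun n (p + l) (p + 1) := by
      rw [descendingRun, descendingRun, show p + (l + 1) + 1 - (p + 1) = l + 1 by omega,
        show p + l + 1 - (p + 1) = l by omega, List.range'_concat, List.reverse_append]
      simp only [List.reverse_cons, List.reverse_nil, List.nil_append, List.singleton_append,
        List.map_cons, List.prod_cons]
      rw [show p + 1 + 1 * l = p + l + 1 by omega]
    have ih' := ih (by omega)
    rw [h, Equiv.Perm.mul_apply, simple, dif_pos ⟨by omega, by omega⟩, Equiv.swap_apply_def]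
    generalize descendingRun n (p + l) (p + 1) x = y at ih' ⊢
    simp only [apply_ite Fin.val, Fin.ext_iff, Nat.add_sub_cancel]
    split_ifs at ih' ⊢ <;> omega

/-- The conditions on `p` and `d` under which `runProduct n p d k` is described below. -/
structure RunData (n k : ℕ) (p d : ℕ → ℕ) : Prop where
  spacing : ∀ i j, i < j → j < k → p i + 2 ≤ p j
  mono : ∀ i j, i < j → j < k → d i < d j
  lt : ∀ i < k, p i < d i
  lt_n : ∀ i < k, d i < n

/-- The product of the first `k` of the runs from `d i` to `p i + 1`. -/
def runProduct (n : ℕ) (p d : ℕ → ℕ) (k : ℕ) : Equiv.Perm (Fin n) :=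
  ((List.range k).map fun i => descendingRun n (d i) (p i + 1)).prod

theorem runProduct_succ (n : ℕ) (p d : ℕ → ℕ) (k : ℕ) :
    runProduct n p d (k + 1) = runProduct n p d k * descendingRun n (d k) (p k + 1) := by
  simp [runProduct, List.range_succ]

namespace RunData

variable {n k : ℕ} {p d : ℕ → ℕ}

theorem pred (h : RunData n (k + 1) p d) : RunData n k p d :=
  ⟨fun i j hij hj => h.spacing i j hij (by omega), fun i j hij hj => h.mono i j hij (by omega),
    fun i hi => h.lt i (by omega), fun i hi => h.lt_n i (by omega)⟩

theorem last_apply (h : RunData n (k + 1) p d) (x : Fin n) :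
    (descendingRun n (d k) (p k + 1) x : ℕ) =
      if (x : ℕ) = p k then d k else
        if p k < (x : ℕ) ∧ (x : ℕ) ≤ d k then (x : ℕ) - 1 else x :=
  descendingRun_apply (h.lt k (Nat.lt_succ_self k)).le (h.lt_n k (Nat.lt_succ_self k)) x

/-- The last run moves points only within [p_k, d_k], to the right of every earlier p_i; this lets
inductions peel off the last run. -/
theorem last_notMem (h : RunData n (k + 1) p d) {x : Fin n} (hx : ∀ i < k, p i ≠ x) :
    ∀ i < k, p i ≠ descendingRun n (d k) (p k + 1) x := by
  intro i hi
  have h1 := h.last_apply x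
  have h2 := h.spacing i k hi (Nat.lt_succ_self k)
  have h3 := h.lt k (Nat.lt_succ_self k)
  have h4 := hx i hi
  split_ifs at h1 <;> omega

theorem apply_le (h : RunData n k p d) {x : Fin n} (hx : ∀ i < k, p i ≠ x) :
    runProduct n p d k x ≤ x := by
  induction k generalizing x with
  | zero => simp [runProduct]
  | succ k ih =>
    rw [runProduct_succ, Equiv.Perm.mul_apply]
    refine (ih h.pred (h.last_notMem fun i hi => hx i (by omega))).trans ?_
    have h1 := h.last_apply x
    rw [if_neg (hx k (Nat.lt_succ_self k)).symm] at h1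
    rw [Fin.le_iff_val_le_val]
    split_ifs at h1 <;> omega

theorem apply_lt_apply (h : RunData n k p d) {x y : Fin n} (hx : ∀ i < k, p i ≠ x)
    (hy : ∀ i < k, p i ≠ y) (hxy : x < y) : runProduct n p d k x < runProduct n p d k y := by
  induction k generalizing x y with
  | zero => simpa [runProduct] using hxy
  | succ k ih =>
    rw [runProduct_succ, Equiv.Perm.mul_apply, Equiv.Perm.mul_apply]
    refine ih h.pred (h.last_notMem fun i hi => hx i (by omega))
      (h.last_notMem fun i hi => hy i (by omega)) ?_
    have h1 := h.last_apply x
    have h2 := h.last_apply y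
    rw [if_neg (hx k (Nat.lt_succ_self k)).symm] at h1
    rw [if_neg (hy k (Nat.lt_succ_self k)).symm] at h2
    have h3 := hx k (Nat.lt_succ_self k)
    rw [Fin.lt_def] at hxy ⊢
    split_ifs at h1 h2 <;> omega

theorem apply_of_lt (h : RunData n k p d) {x : Fin n} (hx : ∀ i < k, d i < x ∨ (x : ℕ) < p i) :
    runProduct n p d k x = x := by
  induction k with
  | zero => rfl
  | succ k ih =>
    have h1 : descendingRun n (d k) (p k + 1) x = x := by
      have h1 := h.last_apply x
      have h2 := hx k (Nat.lt_succ_self k)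
      have h3 := h.lt k (Nat.lt_succ_self k)
      rw [Fin.ext_iff]
      split_ifs at h1 <;> omega
    rw [runProduct_succ, Equiv.Perm.mul_apply, h1]
    exact ih h.pred fun i hi => hx i (by omega)

theorem apply_eq (h : RunData n k p d) {i : ℕ} (hi : i < k) {x : Fin n} (hx : p i = x) :
    (runProduct n p d k x : ℕ) = d i := by
  induction k generalizing x with
  | zero => omega
  | succ k ih =>
    have h1 := h.last_apply x
    rw [runProduct_succ, Equiv.Perm.mul_apply]
    rcases Nat.lt_succ_iff_lt_or_eq.1 hi with hik | rfl
    · have h2 := h.spacing i k hik (Nat.lt_succ_self k)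
      refine ih h.pred hik ?_
      split_ifs at h1 <;> omega
    · rw [if_pos hx.symm] at h1
      rw [h.pred.apply_of_lt, h1]
      -- The earlier runs do not move d_k, since they act only up to smaller heads.
      intro j hj
      rw [h1]
      exact Or.inl (h.mono j i hj (Nat.lt_succ_self i))

theorem apply_lt (h : RunData n k p d) {x : Fin n} (hx : ∀ i < k, p i ≠ x) {i : ℕ} (hi : i < k)
    (h1 : p i ≤ x) (h2 : (x : ℕ) ≤ d i) : runProduct n p d k x < x := by
  induction k with
  | zero => omega
  | succ k ih =>
    have hk := Nat.lt_succ_self k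
    have h3 := h.last_apply x
    rw [if_neg (hx k hk).symm] at h3
    rw [runProduct_succ, Equiv.Perm.mul_apply]
    split_ifs at h3 with hc
    · refine (h.pred.apply_le (h.last_notMem fun i hi => hx i (by omega))).trans_lt ?_
      rw [Fin.lt_def]
      omega
    · rw [Fin.ext h3]
      rcases Nat.lt_succ_iff_lt_or_eq.1 hi with hik | rfl
      · exact ih h.pred (fun i hi => hx i (by omega)) hik
      · have := hx i hk
        omega

theorem apply_eq_self_iff (h : RunData n k p d) (x : Fin n) :
    runProduct n p d k x = x ↔ ∀ i < k, d i < x ∨ (x : ℕ) < p i := by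
  refine ⟨fun hx i hi => ?_, h.apply_of_lt⟩
  have hne : ∀ i < k, p i ≠ x := by
    intro i hi e
    have h1 := h.apply_eq hi e
    rw [hx] at h1
    have := h.lt i hi
    omega
  by_contra hc
  have := h.apply_lt hne hi (by omega) (by omega)
  rw [hx] at this
  exact lt_irrefl _ this

theorem lt_apply_iff (h : RunData n k p d) (x : Fin n) :
    x < runProduct n p d k x ↔ ∃ i < k, p i = x := by
  constructor
  · intro hx
    by_contra hc
    push Not at hc
    exact absurd hx (not_lt.2 (h.apply_le hc))
  · rintro ⟨i, hi, e⟩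
    rw [Fin.lt_def, h.apply_eq hi e, ← e]
    exact h.lt i hi

theorem enumerates (h : RunData n k p d) : Enumerates k p
    fun x => ∃ hx : x < n, (⟨x, hx⟩ : Fin n) < runProduct n p d k ⟨x, hx⟩ := by
  refine ⟨fun i j hij hj => by have := h.spacing i j hij hj; omega, fun x => ⟨?_, ?_⟩⟩
  · rintro ⟨hx, e⟩
    exact (h.lt_apply_iff _).1 e
  · rintro ⟨i, hi, rfl⟩
    exact ⟨(h.lt i hi).trans (h.lt_n i hi), (h.lt_apply_iff _).2 ⟨i, hi, rfl⟩⟩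

theorem apply_lt_apply_of_mem (h : RunData n k p d) {x y : Fin n}
    (hx : x < runProduct n p d k x) (hy : y < runProduct n p d k y) (hxy : x < y) :
    runProduct n p d k x < runProduct n p d k y := by
  obtain ⟨i, hi, ei⟩ := (h.lt_apply_iff x).1 hx
  obtain ⟨j, hj, ej⟩ := (h.lt_apply_iff y).1 hy
  rw [Fin.lt_def] at hxy ⊢
  rw [h.apply_eq hi ei, h.apply_eq hj ej]
  exact h.mono i j (h.enumerates.of_lt hi (by omega)) hj

theorem apply_lt_apply_of_notMem (h : RunData n k p d) {x y : Fin n}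
    (hx : runProduct n p d k x ≤ x) (hy : runProduct n p d k y ≤ y) (hxy : x < y) :
    runProduct n p d k x < runProduct n p d k y := by
  refine h.apply_lt_apply ?_ ?_ hxy
  · exact fun i hi e => absurd ((h.lt_apply_iff x).2 ⟨i, hi, e⟩) (not_lt.2 hx)
  · exact fun i hi e => absurd ((h.lt_apply_iff y).2 ⟨i, hi, e⟩) (not_lt.2 hy)

theorem avoids321 (h : RunData n k p d) : Avoids321 (runProduct n p d k) := by
  rintro ⟨i, j, l, hij, hjl, h1, h2⟩
  have hm := fun x y => h.apply_lt_apply_of_mem (x := x) (y := y)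
  have hn := fun x y => h.apply_lt_apply_of_notMem (x := x) (y := y)
  -- Of three positions, two are both excedances or both not, and on either class the permutation
  -- increases.
  generalize runProduct n p d k = π at *
  by_cases hi : i < π i <;> by_cases hj : j < π j <;> by_cases hl : l < π l
  all_goals first
    | exact absurd (hm i j hi hj hij) (not_lt.2 h1.le)
    | exact absurd (hm j l hj hl hjl) (not_lt.2 h2.le)
    | exact absurd (hm i l hi hl (hij.trans hjl)) (not_lt.2 (h2.trans h1).le)
    | exact absurd (hn i j (not_lt.1 hi) (not_lt.1 hj) hij) (not_lt.2 h1.le)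
    | exact absurd (hn j l (not_lt.1 hj) (not_lt.1 hl) hjl) (not_lt.2 h2.le)
    | exact absurd (hn i l (not_lt.1 hi) (not_lt.1 hl) (hij.trans hjl)) (not_lt.2 (h2.trans h1).le)

theorem avoids3bar142 (h : RunData n k p d) : Avoids3bar142 (runProduct n p d k) := by
  intro i j l hij hjl h1 h2
  have hm := fun x y => h.apply_lt_apply_of_mem (x := x) (y := y)
  have hn := fun x y => h.apply_lt_apply_of_notMem (x := x) (y := y)
  have hl : ¬ l < runProduct n p d k l := by
    intro hl
    by_cases hj : j < runProduct n p d k j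
    · exact absurd (hm j l hj hl hjl) (not_lt.2 (h2.trans h1).le)
    · exact absurd (((hl.trans h2).trans h1).trans_le (not_lt.1 hj)) (not_lt.2 hjl.le)
  have hi : i < runProduct n p d k i := by
    by_contra hi
    exact absurd (hn i l (not_lt.1 hi) (not_lt.1 hl) (hij.trans hjl)) (not_lt.2 h2.le)
  have hj : j < runProduct n p d k j := by
    by_contra hj
    exact absurd (hn j l (not_lt.1 hj) (not_lt.1 hl) hjl) (not_lt.2 (h2.trans h1).le)
  obtain ⟨a, ha, ea⟩ := (h.lt_apply_iff i).1 hi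
  obtain ⟨b, hb, eb⟩ := (h.lt_apply_iff j).1 hj
  rw [Fin.lt_def] at hij hjl
  have hab := h.spacing a b (h.enumerates.of_lt ha (by omega)) hb
  have hmn : (i : ℕ) + 1 < n := by omega
  -- Positions i and j are excedances, so they differ by at least 2 and i + 1 is not an excedance;
  -- neither is l, so the value at i + 1 is below that at l.
  refine ⟨⟨i + 1, hmn⟩, ?_, ?_, ?_⟩
  · rw [Fin.lt_def]
    simp only
    omega
  · rw [Fin.lt_def]
    simp only
    omega
  · refine hn _ _ ?_ (not_lt.1 hl) ?_
    · refine not_lt.1 fun hc => ?_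
      obtain ⟨c, hc, ec⟩ := (h.lt_apply_iff _).1 hc
      simp only at ec
      have := h.spacing a c (h.enumerates.of_lt ha (by omega)) hc
      omega
    · rw [Fin.lt_def]
      simp only
      omega

end RunData

/-! ### Image, fixed points and injectivity of φ -/

theorem Encodes.runData {n k : ℕ} {w : Fin n → Step} {u d : ℕ → ℕ} (h : Encodes w k u d) :
    RunData n k (fun i => shift d i (u i)) d := by
  refine ⟨fun i j hij => ?_, h.down.lt, fun i hi => h.shift_lt_down hi,
    fun i hi => (h.down.mem hi).1⟩
  induction j, hij using Nat.le_induction with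
  | base => exact fun hj => h.shift_spacing hj
  | succ j hij ih =>
    intro hj
    have h1 := ih (by omega)
    have h2 := h.shift_spacing hj
    omega

theorem Encodes.phi_eq {n k : ℕ} {P : MotzkinPath n} {u d : ℕ → ℕ} (h : Encodes P.1 k u d) :
    phi P = runProduct n (fun i => shift d i (u i)) d k := by
  rw [phi, h.numUps_eq, h.stripParams_eq, List.map_map]
  rfl

theorem phi_mem_avoiders {n : ℕ} (P : MotzkinPath n) : phi P ∈ avoiders n := by
  obtain ⟨k, u, d, h⟩ := P.2.exists_encodes
  rw [h.phi_eq]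
  exact ⟨h.runData.avoids321, h.runData.avoids3bar142⟩

theorem numFixed_phi {n : ℕ} (P : MotzkinPath n) : numFixed (phi P) = axisHorizontals P := by
  obtain ⟨k, u, d, h⟩ := P.2.exists_encodes
  rw [h.phi_eq, numFixed, axisHorizontals]
  congr 1
  refine Finset.filter_congr fun x _ => ?_
  rw [h.runData.apply_eq_self_iff, h.axis_iff]

theorem phi_injective (n : ℕ) : Function.Injective (phi (n := n)) := by
  intro P Q hPQ
  obtain ⟨k, u, d, h⟩ := P.2.exists_encodes
  obtain ⟨k', u', d', h'⟩ := Q.2.exists_encodes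
  rw [h.phi_eq, h'.phi_eq] at hPQ
  have he := h'.runData.enumerates
  rw [← hPQ] at he
  obtain ⟨hk, hp⟩ := h.runData.enumerates.unique he
  subst hk
  have hd : ∀ i < k, d i = d' i := by
    intro i hi
    have hn := (h.runData.lt i hi).trans (h.runData.lt_n i hi)
    rw [← h.runData.apply_eq hi (x := ⟨_, hn⟩) rfl, hPQ]
    exact h'.runData.apply_eq hi (hp i hi).symm
  refine Subtype.ext (h.path_ext h' (fun i hi => ?_) hd)
  have hs : ∀ x, shift d' i x = shift d i x := by
    intro x
    rw [shift, shift]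
    congr 2
    refine Finset.filter_congr fun j hj => ?_
    rw [hd j (by have := Finset.mem_range.1 hj; omega)]
  have hpi := hp i hi
  simp only [hs] at hpi
  have hm : ∀ a b, a < b → b < i → d a < d b := fun a b hab hb => h.down.lt a b hab (by omega)
  -- Neither `u i` nor `u' i` is a down position, so strict growth of the shift separates them if
  -- they differ.
  rcases lt_trichotomy (u i) (u' i) with hc | hc | hc
  · have := shift_lt hm hc fun j hj => by
      rw [hd j (by omega)]
      exact (h'.ne hi (by omega)).symm
    omega
  · exact hc
  · have := shift_lt hm hc fun j hj => (h.ne hi (by omega)).symm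
    omega

/-! ### Permutations that avoid both patterns -/

section Perm

variable {n : ℕ} {π : Equiv.Perm (Fin n)}

/-- Pigeonhole: otherwise the x + 1 values up to x would all be taken at the x positions before x.
-/
theorem exists_gt_apply_le {x : Fin n} (hx : x < π x) : ∃ y, x < y ∧ π y ≤ x := by
  by_contra! hc
  have h1 : (Finset.Iic x).map π.symm.toEmbedding ⊆ Finset.Iio x := by
    intro y hy
    rw [Finset.mem_map_equiv, Equiv.symm_symm, Finset.mem_Iic] at hy
    rw [Finset.mem_Iio]
    rcases lt_trichotomy y x with h | rfl | h
    · exact h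
    · exact absurd hy (not_le.2 hx)
    · exact absurd hy (not_le.2 (hc y h))
  have h2 := Finset.card_le_card h1
  rw [Finset.card_map, Fin.card_Iic, Fin.card_Iio] at h2
  omega

/-- Pigeonhole: otherwise the x + 2 positions 0, …, x and y would have values at most π x ≤ x. -/
theorem exists_lt_lt_apply {x y : Fin n} (hxy : x < y) (h : π y < π x) (hx : π x ≤ x) :
    ∃ z, z < x ∧ π x < π z := by
  by_contra! hc
  have h1 : (insert y (Finset.Iic x)).map π.toEmbedding ⊆ Finset.Iic (π x) := by
    intro v hv
    rw [Finset.mem_map] at hv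
    obtain ⟨z, hz, rfl⟩ := hv
    rw [Finset.mem_insert, Finset.mem_Iic] at hz
    rw [Finset.mem_Iic]
    rcases hz with rfl | hz
    · exact h.le
    · rcases hz.lt_or_eq with hz | rfl
      · exact hc z hz
      · exact le_rfl
  have h2 := Finset.card_le_card h1
  rw [Finset.card_map, Finset.card_insert_of_notMem (by simpa using hxy), Fin.card_Iic,
    Fin.card_Iic] at h2
  rw [Fin.le_def] at hx
  omega

/-- A descent from x to an excedance y would be completed to 321 by a later entry that is at most y.
-/
theorem Avoids321.apply_lt_apply_of_mem (h : Avoids321 π) {x y : Fin n} (hxy : x < y)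
    (hy : y < π y) : π x < π y := by
  by_contra hc
  obtain ⟨z, hz, hzy⟩ := exists_gt_apply_le hy
  have hne : π y ≠ π x := fun e => hxy.ne' (π.injective e)
  exact h ⟨x, y, z, hxy, hz, lt_of_le_of_ne (not_lt.1 hc) hne, hzy.trans_lt hy⟩

/-- An inversion that starts at a non-excedance would be completed to 321 by an earlier, larger
entry. -/
theorem Avoids321.apply_lt_apply_of_notMem (h : Avoids321 π) {x y : Fin n} (hxy : x < y)
    (hx : π x ≤ x) : π x < π y := by
  by_contra hc
  have hlt : π y < π x := lt_of_le_of_ne (not_lt.1 hc) fun e => hxy.ne' (π.injective e)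
  obtain ⟨z, hz, hzx⟩ := exists_lt_lt_apply hxy hlt hx
  exact h ⟨z, x, y, hz, hxy, hzx, hlt⟩

/-- A later entry at most x turns x, y into a 231, and adjacent positions leave no place for the
required entry between them. -/
theorem Avoids3bar142.ne_succ (h : Avoids3bar142 π) {x y : Fin n} (hx : x < π x) (hy : y < π y)
    (hlt : π x < π y) : (y : ℕ) ≠ x + 1 := by
  intro e
  obtain ⟨z, hz, hzx⟩ := exists_gt_apply_le hx
  have hyz : y < z := by
    rw [Fin.lt_def] at *
    rw [Fin.le_def] at hzx
    have : (y : ℕ) ≠ z := by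
      intro e'
      have := Fin.ext e'
      subst this
      omega
    omega
  obtain ⟨m, h1, h2, -⟩ := h x y z (by rw [Fin.lt_def]; omega) hyz hlt (hzx.trans_lt hx)
  rw [Fin.lt_def] at h1 h2
  omega

theorem exists_runData (hπ : π ∈ avoiders n) : ∃ k p d, RunData n k p d ∧
    (∀ x : Fin n, x < π x ↔ ∃ i < k, p i = x) ∧
      ∀ x : Fin n, ∀ i < k, p i = x → (π x : ℕ) = d i := by
  obtain ⟨p, hp⟩ := exists_enumerates ((Finset.univ.filter fun x => x < π x).map Fin.valEmbedding)
  generalize ((Finset.univ.filter fun x => x < π x).map Fin.valEmbedding).card = k at hp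
  have hmem : ∀ x : Fin n, x < π x ↔ ∃ i < k, p i = x := by
    intro x
    rw [← hp.iff]
    exact ⟨fun h => Finset.mem_map.2 ⟨x, by simpa using h, rfl⟩, fun h => by
      obtain ⟨y, hy, e⟩ := Finset.mem_map.1 h
      rw [← Fin.ext e]
      simpa using hy⟩
  have hlt : ∀ i < k, p i < n := by
    intro i hi
    have := hp.mem hi
    rw [Finset.mem_map] at this
    obtain ⟨x, -, e⟩ := this
    rw [← e]
    exact x.2
  have hval : ∀ i (hi : i < k), (⟨p i, hlt i hi⟩ : Fin n) < π ⟨p i, hlt i hi⟩ :=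
    fun i hi => (hmem _).2 ⟨i, hi, rfl⟩
  have hmono : ∀ i j (hij : i < j) (hj : j < k),
      π ⟨p i, hlt i (hij.trans hj)⟩ < π ⟨p j, hlt j hj⟩ := fun i j hij hj =>
    hπ.1.apply_lt_apply_of_mem (hp.lt i j hij hj) (hval j hj)
  refine ⟨k, p, fun i => if h : i < k then π ⟨p i, hlt i h⟩ else 0, ⟨?_, ?_, ?_, ?_⟩, hmem, ?_⟩
  · intro i j hij hj
    have h1 := hπ.2.ne_succ (hval i (hij.trans hj)) (hval j hj) (hmono i j hij hj)
    have h2 := hp.lt i j hij hj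
    simp only at h1
    omega
  · intro i j hij hj
    simp only [dif_pos hj, dif_pos (hij.trans hj)]
    exact hmono i j hij hj
  · intro i hi
    simp only [dif_pos hi]
    exact hval i hi
  · intro i hi
    simp only [dif_pos hi]
    exact Fin.is_lt _
  · intro x i hi e
    simp only [dif_pos hi]
    congr 2
    exact Fin.ext e.symm

/-- A permutation is determined by its values on a set off which it is increasing. -/
theorem perm_eq_of_eqOn {ρ : Equiv.Perm (Fin n)} (q : Fin n → Prop) (hq : ∀ x, q x → π x = ρ x)
    (hπ : ∀ x y, x < y → ¬ q x → ¬ q y → π x < π y)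
    (hρ : ∀ x y, x < y → ¬ q x → ¬ q y → ρ x < ρ y) : π = ρ := by
  -- At a first disagreement with α x < β x, the value α x must be taken by β at a later y; then `q
  -- y` contradicts injectivity of α, and `¬ q y` contradicts the increase of β. Used for both
  -- orders of π and ρ.
  have key : ∀ (α β : Equiv.Perm (Fin n)) (x : Fin n), (∀ x, q x → α x = β x) →
      (∀ x y, x < y → ¬ q x → ¬ q y → β x < β y) → (∀ y < x, α y = β y) → ¬ q x →
      ¬ α x < β x := by
    intro α β x hαβ hβ ih hx hlt
    obtain ⟨y, hy⟩ := β.surjective (α x)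
    rcases lt_trichotomy y x with h | rfl | h
    · rw [← ih y h] at hy
      exact h.ne (α.injective hy)
    · exact hlt.ne hy.symm
    · by_cases hqy : q y
      · rw [← hαβ y hqy] at hy
        exact h.ne' (α.injective hy)
      · have := hβ x y h hx hqy
        rw [hy] at this
        exact lt_asymm hlt this
  ext x
  congr 1
  induction x using WellFoundedLT.induction with
  | _ x ih =>
    by_cases hx : q x
    · exact hq x hx
    · exact le_antisymm (not_lt.1 (key ρ π x (fun y hy => (hq y hy).symm) hπ
        (fun y hy => (ih y hy).symm) hx)) (not_lt.1 (key π ρ x hq hρ ih hx))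

end Perm

/-! ### Surjectivity: recovering the path from the excedances -/

theorem RunData.exists_encodes {n k : ℕ} {p d : ℕ → ℕ} (h : RunData n k p d) :
    ∃ (w : Fin n → Step) (u : ℕ → ℕ), Encodes w k u d ∧ ∀ i < k, shift d i (u i) = p i := by
  classical
  -- This yields i ≤ p_i, the range in which `exists_shift_eq` provides a preimage.
  have hp : ∀ i < k, 2 * i ≤ p i := by
    intro i
    induction i with
    | zero => omega
    | succ i ih =>
      intro hi
      have h1 := ih (by omega)
      have h2 := h.spacing i (i + 1) (by omega) hi
      omega
  have hex : ∀ i, ∃ x, i < k → shift d i x = p i ∧ ∀ j < i, d j ≠ x := by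
    intro i
    by_cases hi : i < k
    · have h0 : ∀ j < i, d j ≠ 0 := by
        intro j hj
        have := h.lt j (hj.trans hi)
        omega
      have h1 := hp i hi
      obtain ⟨x, hx⟩ := exists_shift_eq h0 (show i ≤ p i by omega)
      exact ⟨x, fun _ => hx⟩
    · exact ⟨0, fun h => absurd h hi⟩
  choose u hu using hex
  have hle : ∀ i < k, u i ≤ p i := fun i hi => (le_shift d i (u i)).trans_eq (hu i hi).1
  have hlt : ∀ i < k, u i < d i := fun i hi => (hle i hi).trans_lt (h.lt i hi)
  have hne : ∀ i < k, ∀ j < k, u i ≠ d j := by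
    intro i hi j hj e
    rcases lt_trichotomy j i with hji | rfl | hij
    · exact (hu i hi).2 j hji e.symm
    · have := hlt j hj
      omega
    · have h1 := hlt i hi
      have h2 := h.mono i j hij hj
      omega
  -- If `u (i + 1)` ≤ `u i`, monotonicity of `shift d (i + 1)` gives p_{i+1} ≤ p_i + 1, against the
  -- spacing of 2.
  have hstep : ∀ i, i + 1 < k → u i < u (i + 1) := by
    intro i hi
    by_contra hc
    have h1 := shift_mono (d := d) (i := i + 1)
      (fun a b hab hb => h.mono a b hab (by omega)) (not_lt.1 hc)
    rw [shift_succ d i (u i), (hu i (by omega)).1, (hu (i + 1) hi).1] at h1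
    have h2 := h.spacing i (i + 1) (by omega) hi
    split_ifs at h1 <;> omega
  have hmono : ∀ i j, i < j → j < k → u i < u j := by
    intro i j hij
    induction j, hij using Nat.le_induction with
    | base => exact hstep i
    | succ j hij ih => exact fun hj => (ih (by omega)).trans (hstep j hj)
  refine ⟨fun x => if ∃ i < k, u i = x then .U else if ∃ i < k, d i = x then .D else .H, u,
    ⟨⟨hmono, fun x => ⟨?_, ?_⟩⟩, ⟨h.mono, fun x => ⟨?_, ?_⟩⟩, hlt⟩, fun i hi => (hu i hi).1⟩
  · rintro ⟨hx, e⟩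
    by_contra hc
    simp only [if_neg hc] at e
    split_ifs at e
  · intro hx
    refine ⟨?_, if_pos hx⟩
    obtain ⟨i, hi, rfl⟩ := hx
    exact (hlt i hi).trans (h.lt_n i hi)
  · rintro ⟨hx, e⟩
    by_contra hc
    simp only [if_neg hc] at e
    split_ifs at e
  · rintro ⟨i, hi, rfl⟩
    refine ⟨h.lt_n i hi, ?_⟩
    simp only
    rw [if_neg, if_pos ⟨i, hi, rfl⟩]
    rintro ⟨j, hj, e⟩
    exact hne j hj i hi e

theorem exists_phi_eq {n : ℕ} {π : Equiv.Perm (Fin n)} (hπ : π ∈ avoiders n) :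
    ∃ P, phi P = π := by
  obtain ⟨k, p, d, h, hmem, hval⟩ := exists_runData hπ
  obtain ⟨w, u, hw, hu⟩ := h.exists_encodes
  refine ⟨⟨w, hw.isMotzkin⟩, ?_⟩
  have hw' : Encodes (⟨w, hw.isMotzkin⟩ : MotzkinPath n).1 k u d := hw
  have hr := hw.runData
  rw [hw'.phi_eq]
  -- Both permutations take the values d_i at the excedances p_i of π and increase elsewhere.
  refine perm_eq_of_eqOn (fun x => x < π x) ?_ ?_ ?_
  · intro x hx
    obtain ⟨i, hi, e⟩ := (hmem x).1 hx
    refine Fin.ext ?_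
    rw [hval x i hi e]
    exact hr.apply_eq hi ((hu i hi).trans e)
  · have hnot : ∀ x : Fin n, ¬ x < π x → ∀ i < k, shift d i (u i) ≠ x := by
      intro x hx i hi e
      rw [hu i hi] at e
      exact hx ((hmem x).2 ⟨i, hi, e⟩)
    exact fun x y hxy hx hy => hr.apply_lt_apply (hnot x hx) (hnot y hy) hxy
  · exact fun x y hxy hx _ => hπ.1.apply_lt_apply_of_notMem hxy (not_lt.1 hx)

end RiordanPaths

theorem mainTheorem3 (n : ℕ) :
    Set.BijOn (RiordanPaths.phi (n := n)) Set.univ (RiordanPaths.avoiders n) ∧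
    (∀ P : RiordanPaths.MotzkinPath n,
      RiordanPaths.numFixed (RiordanPaths.phi P) = RiordanPaths.axisHorizontals P) ∧
    ∀ m : ℕ, Set.BijOn (RiordanPaths.phi (n := n))
      {P | RiordanPaths.axisHorizontals P = m}
      {π | π ∈ RiordanPaths.avoiders n ∧ RiordanPaths.numFixed π = m} := by
  refine ⟨⟨fun P _ => RiordanPaths.phi_mem_avoiders P, (RiordanPaths.phi_injective n).injOn,
    fun π hπ => ?_⟩, RiordanPaths.numFixed_phi, fun m => ⟨fun P hP => ?_,
      (RiordanPaths.phi_injective n).injOn, fun π hπ => ?_⟩⟩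
  · obtain ⟨P, hP⟩ := RiordanPaths.exists_phi_eq hπ
    exact ⟨P, trivial, hP⟩
  · exact ⟨RiordanPaths.phi_mem_avoiders P, (RiordanPaths.numFixed_phi P).trans hP⟩
  · obtain ⟨P, hP⟩ := RiordanPaths.exists_phi_eq hπ.1
    refine ⟨P, ?_, hP⟩
    rw [Set.mem_ofPred_eq, ← RiordanPaths.numFixed_phi, hP]
    exact hπ.2
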